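/- Fix a standard enumeration $\varphi_0,\varphi_1,\dots$ of the partial computable functions $\mathbb{N}\rightharpoonup\mathbb{N}$; let $\mathcal{W}_e=\operatorname{dom}\varphi_e$ and $\mathcal{K}=\{e:\varphi_e(e)\downarrow\}$. For $A\subseteq\mathbb{N}$ write $A(\cdot)$ for the characteristic function of $A$ and $\overline{A}$ for its complement. Call a recursively enumerable set $A$ - *$D$-w.e.u.* if there is a computable map $f$ from $\mathbb{N}$ to the finite subsets of $\mathbb{N}$ (effectively coded by natural numbers) such that for all $e$: if $\varphi_e(z)\downarrow$ for all $z\in f(e)$, then $\varphi_e(z)\neq A(z)$ for some $z\in f(e)$; - *effectively simple* if $\overline{A}$ is infinite and there is a computable $f\colon\mathbb{N}\to\mathbb{N}$ such that for all $e$: if $\mathcal{W}_e\subseteq\overline{A}$, then $|\mathcal{W}_e|\le f(e)$; - *$T$-complete* if every recursively enumerable set is Turing reducible to $A$. A *recursive enumeration of $A$ without repetitions* is a computable injective function $a\colon\mathbb{N}\to\mathbb{N}$ with range $A$; its *deficiency set* is $\mathcal{D}_a=\{s:\exists t>s\ [a(t)<a(s)]\}$. **Theorem.** 1. If $a$ is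 a recursive enumeration without repetitions of a $D$-w.e.u. set $A$, then the deficiency set $\mathcal{D}_a$ is effectively simple. 2. Every $D$-w.e.u. set is $T$-complete. 3. For every recursive enumeration $a$ of $\mathcal{K}$ without repetitions, the deficiency set $\mathcal{D}_a$ is effectively simple. -/

import Mathlib

open Nat.Partrec (Code)

namespace RecThy

/-- The `e`-th partial computable function of one argument. -/
def phi (e : ℕ) : ℕ →. ℕ := (Denumerable.ofNat Code e).eval

/-- The `e`-th recursively enumerable set. -/
def W (e : ℕ) : Set ℕ := {n | (phi e n).Dom}

/-- The diagonal halting set. -/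
def K : Set ℕ := {e | (phi e e).Dom}

/-- The characteristic function of `A`, with values `1` on `A` and `0` off `A`. -/
noncomputable def chi (A : Set ℕ) : ℕ → ℕ := A.indicator (fun _ => 1)

/-- `A` is recursively enumerable. -/
def IsRE (A : Set ℕ) : Prop := REPred (fun n => n ∈ A)

/-- `B` is Turing reducible to `A`. -/
def TuringRed (B A : Set ℕ) : Prop :=
  TuringReducible (fun n => Part.some (chi B n)) (fun n => Part.some (chi A n))

/-- `A` is `T`-complete: it is r.e. and every r.e. set is Turing reducible to it. -/
def TComplete (A : Set ℕ) : Prop := IsRE A ∧ ∀ B : Set ℕ, IsRE B → TuringRed B A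

/-- `a` is a recursive enumeration of `A` without repetitions. -/
structure IsEnumeration (a : ℕ → ℕ) (A : Set ℕ) : Prop where
  computable : Computable a
  injective : Function.Injective a
  range_eq : Set.range a = A

/-- The deficiency set of an enumeration. -/
def deficiencySet (a : ℕ → ℕ) : Set ℕ := {s | ∃ t, s < t ∧ a t < a s}

/-- `A` is effectively simple: r.e., with infinite complement, and the size of the r.e. subsets
of the complement is bounded computably in their index. -/
def EffectivelySimple (A : Set ℕ) : Prop :=
  IsRE A ∧ Aᶜ.Infinite ∧
    ∃ f : ℕ → ℕ, Computable f ∧ ∀ e, W e ⊆ Aᶜ → (W e).encard ≤ (f e : ℕ∞)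

/-- `A` is `D`-w.e.u. Finite sets of naturals are coded by naturals through the bijection of
the `Denumerable (Finset ℕ)` instance (a finite set is listed in increasing order, and the list
of gaps is coded); `Computable f` refers to that coding. -/
def DWEU (A : Set ℕ) : Prop :=
  IsRE A ∧ ∃ f : ℕ → Finset ℕ, Computable f ∧
    ∀ e, (∀ z ∈ f e, (phi e z).Dom) → ∃ z ∈ f e, phi e z ≠ Part.some (chi A z)

end RecThy

open Encodable Denumerable

/-! A nondeficient stage `s` settles `A` below `a s` (`mem_iff_of_notMem_deficiencySet`). If an r.e.
set of nondeficient stages had an `s` with `a s` above all of `f (g e)`, a program searching that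
set for suitable stages would compute `A` correctly on `f (g e)`, against D-w.e.u.; so `a` is
bounded on the set, and injectivity bounds its size. For completeness, let program `g n` wait until
`n` enters `B` and then answer with the current approximation to `A`. It must err on `f (g n)`, so
`n` enters `B` before `A` settles there or never, and `A` computes such a settling stage. `K` is
D-w.e.u. by diagonalization, with singletons as test sets. -/

theorem Computable.decide_eq {α : Type*} [Primcodable α] {f g : α → ℕ} (hf : Computable f)
    (hg : Computable g) : Computable fun x => decide (f x = g x) :=
  (Primrec.eq (α := ℕ)).decide.to_comp.comp hf hg

theorem Computable.decide_lt {α : Type*} [Primcodable α] {f g : α → ℕ} (hf : Computable f)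
    (hg : Computable g) : Computable fun x => decide (f x < g x) :=
  Primrec.nat_lt.decide.to_comp.comp hf hg

theorem Computable.decide_le {α : Type*} [Primcodable α] {f g : α → ℕ} (hf : Computable f)
    (hg : Computable g) : Computable fun x => decide (f x ≤ g x) :=
  Primrec.nat_le.decide.to_comp.comp hf hg

theorem rfind_some_dom {p : ℕ → Bool} :
    (Nat.rfind fun n => Part.some (p n)).Dom ↔ ∃ n, p n := by
  refine Nat.rfind_dom.trans ?_
  exact ⟨fun ⟨n, hn, _⟩ => ⟨n, (Part.mem_some_iff.1 hn).symm⟩,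
    fun ⟨n, hn⟩ => ⟨n, Part.mem_some_iff.2 hn.symm, fun _ => trivial⟩⟩

theorem Computable₂.rfind {α : Type*} [Primcodable α] {p : α → ℕ → Bool} (hp : Computable₂ p) :
    Partrec fun x => Nat.rfind fun n => Part.some (p x n) :=
  Partrec.rfind hp.partrec₂

theorem Computable.natRecursiveIn {f : ℕ → ℕ} (hf : Computable f) (O : Set (ℕ →. ℕ)) :
    Nat.RecursiveIn O fun n => Part.some (f n) :=
  RecursiveIn.iff_nat.1 hf.partrec.recursiveIn

theorem exists_smn {F : ℕ → ℕ →. ℕ} (hF : Partrec₂ F) :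
    ∃ g : ℕ → ℕ, Computable g ∧ ∀ n z, RecThy.phi (g n) z = F n z := by
  have h : Nat.Partrec fun x => F x.unpair.1 x.unpair.2 :=
    Partrec.nat_iff.1 (hF.comp (Computable.fst.comp Computable.unpair)
      (Computable.snd.comp Computable.unpair))
  obtain ⟨c, hc⟩ := Code.exists_code.1 h
  refine ⟨fun n => encode (Code.curry c n), ?_, fun n x => ?_⟩
  · exact Computable.encode.comp
      (Code.primrec₂_curry.to_comp.comp (Computable.const c) Computable.id)
  · simp [RecThy.phi, Code.eval_curry, hc]

/-! ### Codes of finite sets. -/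

/-- Pairing dominates the sum of its components, so the code dominates the sum of the gaps; the
successor in the list coding absorbs the shift from `m` to `m + 1`. -/
theorem le_add_encode_lower' : ∀ (l : List ℕ) (n z : ℕ), z ∈ l → z ≤ n + encode (lower' l n)
  | [], _, _, h => by simp at h
  | m :: l, n, z, h => by
    have hp := Nat.add_le_pair (m - n) (encode (lower' l (m + 1)))
    have he : encode (lower' (m :: l) n) =
        Nat.succ (Nat.pair (m - n) (encode (lower' l (m + 1)))) := by
      simp [lower']
    rcases List.mem_cons.1 h with rfl | h
    · lia
    · have := le_add_encode_lower' l (m + 1) z h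
      lia

/-- The code of a finite set of naturals. -/
def finsetCode (s : Finset ℕ) : ℕ :=
  @encode _ (Primcodable.ofDenumerable (Finset ℕ)).toEncodable s

theorem computable_finsetCode : Computable finsetCode :=
  Computable.encode

theorem finsetCode_eq (s : Finset ℕ) : finsetCode s = encode (lower' (s.sort (· ≤ ·)) 0) := by
  -- The instance first transports `s` along `eqv ℕ`, which is the identity.
  have : s.map (eqv ℕ).toEmbedding = s := by
    ext x; simp [eqv]
  conv_rhs => rw [← this]
  rfl

/-- The members of a finite set of naturals are bounded by its code. -/
theorem le_finsetCode_of_mem {s : Finset ℕ} {z : ℕ} (h : z ∈ s) : z ≤ finsetCode s := by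
  rw [finsetCode_eq]
  simpa using le_add_encode_lower' (s.sort (· ≤ ·)) 0 z (by simpa using h)

theorem computable_singleton {g : ℕ → ℕ} (hg : Computable g) :
    Computable fun n => ({g n} : Finset ℕ) := by
  refine Computable.encode_iff.1 ?_
  refine (Computable.encode.comp (Computable.list_cons.comp hg (Computable.const []))).of_eq
    fun n => ?_
  change _ = finsetCode {g n}
  rw [finsetCode_eq]
  simp [lower']

/-- Every r.e. set is the union of an increasing computable sequence of decidable sets. -/
theorem exists_stages {A : Set ℕ} (hA : RecThy.IsRE A) :
    ∃ R : ℕ → ℕ → Bool, Computable₂ R ∧ (∀ n s t, s ≤ t → R n s → R n t) ∧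
      ∀ n, n ∈ A ↔ ∃ s, R n s := by
  have h : Nat.Partrec fun n => (Part.assert (n ∈ A) fun _ => Part.some ()).map fun _ => 0 :=
    Partrec.nat_iff.1 (Partrec.map hA (Computable.const 0).to₂)
  obtain ⟨c, hc⟩ := Code.exists_code.1 h
  refine ⟨fun n s => (Code.evaln s c n).isSome, ?_, fun n s t hst => ?_, fun n => ?_⟩
  · exact Primrec.option_isSome.to_comp.comp (Code.primrec_evaln.to_comp.comp
      ((Computable.snd.pair (Computable.const c)).pair Computable.fst))
  · simp only [Option.isSome_iff_exists]
    rintro ⟨x, hx⟩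
    exact ⟨x, Code.evaln_mono hst hx⟩
  · have : n ∈ A ↔ (c.eval n).Dom := by rw [hc]; simp [Part.assert]
    rw [this, Part.dom_iff_mem]
    simp only [Code.evaln_complete, Option.isSome_iff_exists, Option.mem_def]
    exact exists_comm

theorem chi_of_mem {A : Set ℕ} {n : ℕ} (h : n ∈ A) : RecThy.chi A n = 1 :=
  Set.indicator_of_mem h _

theorem chi_of_notMem {A : Set ℕ} {n : ℕ} (h : n ∉ A) : RecThy.chi A n = 0 :=
  Set.indicator_of_notMem h _

theorem computable_exists_le_eq {a : ℕ → ℕ} (ha : Computable a) :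
    ∃ M : ℕ → ℕ → Bool, Computable₂ M ∧ ∀ z s, M z s ↔ ∃ i ≤ s, a i = z := by
  refine ⟨fun z s => Nat.rec (motive := fun _ => Bool) (decide (a 0 = z))
    (fun i b => b || decide (a (i + 1) = z)) s, ?_, fun z s => ?_⟩
  · have hstep : Computable₂ fun (p : ℕ × ℕ) (q : ℕ × Bool) =>
        q.2 || decide (a (q.1 + 1) = p.1) :=
      Primrec.or.to_comp.comp (Computable.snd.comp Computable.snd) (Computable.decide_eq
        (ha.comp (Computable.succ.comp (Computable.fst.comp Computable.snd)))
        (Computable.fst.comp Computable.fst))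
    exact Computable.nat_rec (α := ℕ × ℕ) Computable.snd
      (Computable.decide_eq (Computable.const (a 0)) Computable.fst) hstep
  · induction s with
    | zero => simp
    | succ s ih =>
      simp only [Bool.or_eq_true, decide_eq_true_eq, ih, Nat.le_succ_iff]
      constructor
      · rintro (⟨i, hi, h⟩ | h)
        · exact ⟨i, .inl hi, h⟩
        · exact ⟨s + 1, .inr rfl, h⟩
      · rintro ⟨i, hi | rfl, h⟩
        · exact .inl ⟨i, hi, h⟩
        · exact .inr h

/-! ### Deficiency sets. -/

theorem isRE_deficiencySet {a : ℕ → ℕ} (ha : Computable a) :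
    RecThy.IsRE (RecThy.deficiencySet a) := by
  have h : Computable₂ fun s t : ℕ => decide (s < t) && decide (a t < a s) :=
    Primrec.and.to_comp.comp (Computable.decide_lt Computable.fst Computable.snd)
      (Computable.decide_lt (ha.comp Computable.snd) (ha.comp Computable.fst))
  refine h.rfind.dom_re.of_eq fun s => ?_
  rw [rfind_some_dom]
  simp [RecThy.deficiencySet]

/-- Beyond any `N`, an index minimizing `a` is nondeficient. -/
theorem infinite_compl_deficiencySet (a : ℕ → ℕ) :
    (RecThy.deficiencySet a)ᶜ.Infinite := by
  refine Set.infinite_of_not_bddAbove ?_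
  rintro ⟨N, hN⟩
  obtain ⟨s, hs, hmin⟩ := exists_minimalFor_of_wellFoundedLT (· ∈ Set.Ioi N) a ⟨N + 1, by simp⟩
  refine absurd (hN (a := s) ?_) (not_le.2 hs)
  rintro ⟨t, hst, hlt⟩
  exact absurd (hmin (lt_trans hs hst) hlt.le) (not_le.2 hlt)

theorem encard_le_of_forall_lt {a : ℕ → ℕ} (ha : Function.Injective a) {S : Set ℕ} {m : ℕ}
    (h : ∀ s ∈ S, a s < m) : S.encard ≤ m := by
  calc S.encard = (a '' S).encard := (ha.encard_image S).symm
    _ ≤ (Set.Iio m).encard := Set.encard_le_encard (by rintro _ ⟨s, hs, rfl⟩; exact h s hs)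
    _ = m := by
      rw [← Finset.coe_Iio, Set.encard_coe_eq_coe_finsetCard, Nat.card_Iio]

/-- A `z ≤ a s` first listed after `s` would differ from `a s` by injectivity, hence witness that
`s` is deficient. -/
theorem mem_iff_of_notMem_deficiencySet {a : ℕ → ℕ} {A : Set ℕ} (ha : RecThy.IsEnumeration a A)
    {s z : ℕ} (hs : s ∉ RecThy.deficiencySet a) (hz : z ≤ a s) :
    z ∈ A ↔ ∃ i ≤ s, a i = z := by
  rw [← ha.range_eq]
  constructor
  · rintro ⟨t, rfl⟩
    refine ⟨t, ?_, rfl⟩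
    by_contra! hst
    refine hs ⟨t, hst, lt_of_le_of_ne hz fun h => hst.ne' (ha.injective h)⟩
  · rintro ⟨i, -, h⟩
    exact ⟨i, h⟩

/-- Whether `n.unpair.2` steps show that `n.unpair.1` is in the `e`-th r.e. set, and
`z ≤ a n.unpair.1`. -/
def witnessTest (a : ℕ → ℕ) (p : ℕ × ℕ) (n : ℕ) : Bool :=
  (Code.evaln n.unpair.2 (Denumerable.ofNat Code p.1) n.unpair.1).isSome &&
    decide (p.2 ≤ a n.unpair.1)

theorem computable_witnessTest {a : ℕ → ℕ} (ha : Computable a) : Computable₂ (witnessTest a) := by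
  have hu : Computable fun q : (ℕ × ℕ) × ℕ => q.2.unpair := Computable.unpair.comp Computable.snd
  have hc : Computable fun q : (ℕ × ℕ) × ℕ => Denumerable.ofNat Code q.1.1 :=
    (Computable.ofNat Code).comp (Computable.fst.comp Computable.fst)
  have h1 : Computable fun q : (ℕ × ℕ) × ℕ =>
      (Code.evaln q.2.unpair.2 (Denumerable.ofNat Code q.1.1) q.2.unpair.1).isSome :=
    Primrec.option_isSome.to_comp.comp (Code.primrec_evaln.to_comp.comp
      (((Computable.snd.comp hu).pair hc).pair (Computable.fst.comp hu)))
  have h2 : Computable fun q : (ℕ × ℕ) × ℕ => decide (q.1.2 ≤ a q.2.unpair.1) :=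
    Computable.decide_le (Computable.snd.comp Computable.fst) (ha.comp (Computable.fst.comp hu))
  exact Primrec.and.to_comp.comp h1 h2

theorem exists_witnessTest_iff (a : ℕ → ℕ) (e z s : ℕ) :
    (∃ k, witnessTest a (e, z) (Nat.pair s k)) ↔ s ∈ RecThy.W e ∧ z ≤ a s := by
  simp only [witnessTest, Nat.unpair_pair, Bool.and_eq_true, decide_eq_true_eq,
    exists_and_right, RecThy.W, RecThy.phi, Set.mem_ofPred_eq, Part.dom_iff_mem,
    Code.evaln_complete, Option.isSome_iff_exists, Option.mem_def]
  rw [exists_comm]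

/-- The function searching for an element `s` of the `e`-th r.e. set with `z ≤ a s`, and answering
whether `z` is enumerated by `a` up to stage `s`. -/
theorem exists_approximation {a : ℕ → ℕ} (ha : Computable a) :
    ∃ F : ℕ → ℕ →. ℕ, Partrec₂ F ∧
      (∀ e z, (F e z).Dom ↔ ∃ s ∈ RecThy.W e, z ≤ a s) ∧
      ∀ e z v, v ∈ F e z → ∃ s ∈ RecThy.W e, z ≤ a s ∧
        ((∃ i ≤ s, a i = z) → v = 1) ∧ ((¬ ∃ i ≤ s, a i = z) → v = 0) := by
  obtain ⟨M, hM, hMs⟩ := computable_exists_le_eq ha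
  refine ⟨fun e z => (Nat.rfind fun n => Part.some (witnessTest a (e, z) n)).map fun n =>
    cond (M z n.unpair.1) 1 0, ?_, fun e z => ?_, fun e z v hv => ?_⟩
  · have h1 : Partrec fun p : ℕ × ℕ => Nat.rfind fun n => Part.some (witnessTest a p n) :=
      (computable_witnessTest ha).rfind
    have h2 : Computable fun q : (ℕ × ℕ) × ℕ => M q.1.2 q.2.unpair.1 :=
      hM.comp (Computable.snd.comp Computable.fst)
        (Computable.fst.comp (Computable.unpair.comp Computable.snd))
    exact Partrec.map h1 (Computable.cond h2 (Computable.const 1) (Computable.const 0)).to₂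
  · change (Nat.rfind fun n => Part.some (witnessTest a (e, z) n)).Dom ↔ _
    rw [rfind_some_dom]
    constructor
    · rintro ⟨n, hn⟩
      exact ⟨n.unpair.1, (exists_witnessTest_iff a e z _).1 ⟨n.unpair.2, by simpa using hn⟩⟩
    · rintro ⟨s, hs⟩
      obtain ⟨k, hk⟩ := (exists_witnessTest_iff a e z s).2 hs
      exact ⟨_, hk⟩
  · obtain ⟨n, hn, rfl⟩ := (Part.mem_map_iff _).1 hv
    have hn := Nat.rfind_spec hn
    obtain ⟨h1, h2⟩ :=
      (exists_witnessTest_iff a e z n.unpair.1).1 ⟨n.unpair.2, by simpa using hn⟩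
    refine ⟨_, h1, h2, fun h => ?_, fun h => ?_⟩
    · rw [(hMs z _).2 h]; rfl
    · rw [← hMs, Bool.not_eq_true] at h
      rw [h]; rfl

theorem effectivelySimple_deficiencySet {A : Set ℕ} {a : ℕ → ℕ} (hA : RecThy.DWEU A)
    (ha : RecThy.IsEnumeration a A) : RecThy.EffectivelySimple (RecThy.deficiencySet a) := by
  refine ⟨isRE_deficiencySet ha.computable, infinite_compl_deficiencySet a, ?_⟩
  obtain ⟨-, f, hf, hfA⟩ := hA
  obtain ⟨F, hF, hdom, hval⟩ := exists_approximation ha.computable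
  obtain ⟨g, hg, hgF⟩ := exists_smn hF
  refine ⟨fun e => finsetCode (f (g e)), computable_finsetCode.comp (hf.comp hg), fun e he => ?_⟩
  refine encard_le_of_forall_lt ha.injective fun s hs => ?_
  by_contra! hle
  have htot : ∀ z ∈ f (g e), (F e z).Dom := fun z hz =>
    (hdom e z).2 ⟨s, hs, (le_finsetCode_of_mem hz).trans hle⟩
  obtain ⟨z, hz, hne⟩ := hfA (g e) fun z hz => by rw [hgF]; exact htot z hz
  refine hne ?_
  obtain ⟨v, hv⟩ := Part.dom_iff_mem.1 (htot z hz)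
  -- The search may stop at some `t` other than `s`, depending on `z`, but `he` makes every such `t`
  -- nondeficient, so its answer is correct.
  obtain ⟨t, ht, hzt, h1, h0⟩ := hval e z v hv
  rw [← mem_iff_of_notMem_deficiencySet ha (he ht) hzt] at h1 h0
  rw [hgF, Part.eq_some_iff.2 hv]
  by_cases hzA : z ∈ A
  · rw [h1 hzA, chi_of_mem hzA]
  · rw [h0 hzA, chi_of_notMem hzA]

/-- Let `g e` halt on `z` iff `phi e z = 0`. A correct value of `phi e` at `g e` would put `g e` in
`K` iff it is not in `K`. -/
theorem dweu_K : RecThy.DWEU RecThy.K := by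
  have hphi : Partrec₂ RecThy.phi :=
    Code.eval_part.comp ((Computable.ofNat Code).comp Computable.fst) Computable.snd
  have hK : Partrec fun e => RecThy.phi e e := hphi.comp Computable.id Computable.id
  refine ⟨hK.dom_re, ?_⟩
  have hF : Partrec₂ fun e z => (RecThy.phi e z).bind fun v =>
      cond (decide (v = 0)) (Part.some 0) (Part.none : Part ℕ) :=
    Partrec.bind hphi (Partrec.cond (Computable.decide_eq Computable.snd
      (Computable.const 0)) (Computable.const 0).partrec Partrec.none)
  obtain ⟨g, hg, hgF⟩ := exists_smn hF
  refine ⟨fun e => {g e}, computable_singleton hg, fun e _ => ⟨g e, by simp, fun h => ?_⟩⟩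
  have hK : g e ∈ RecThy.K ↔ RecThy.chi RecThy.K (g e) = 0 := by
    change (RecThy.phi (g e) (g e)).Dom ↔ _
    rw [hgF, h]
    by_cases h0 : RecThy.chi RecThy.K (g e) = 0 <;> simp [h0]
  by_cases hm : g e ∈ RecThy.K
  · simp [chi_of_mem hm] at hK; exact hK hm
  · exact hm (hK.2 (chi_of_notMem hm))

/-! ### Turing completeness. -/

/-- Totals recursive in an oracle are closed under bounded sums. -/
theorem recursiveIn_sum_range {O : Set (ℕ →. ℕ)} {s : ℕ → ℕ}
    (hs : Nat.RecursiveIn O fun n => Part.some (s n)) :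
    Nat.RecursiveIn O fun m => Part.some (∑ i ∈ Finset.range m, s i) := by
  have hstep : Nat.RecursiveIn O fun x => Part.some
      (x.unpair.2.unpair.2 + s x.unpair.2.unpair.1) := by
    have hy : Nat.RecursiveIn O fun x => Part.some x.unpair.2.unpair.1 :=
      (Computable.fst.comp (Computable.unpair.comp
        (Computable.snd.comp Computable.unpair))).natRecursiveIn O
    have hi : Nat.RecursiveIn O fun x => Part.some x.unpair.2.unpair.2 :=
      (Computable.snd.comp (Computable.unpair.comp
        (Computable.snd.comp Computable.unpair))).natRecursiveIn O
    have hadd : Nat.RecursiveIn O fun x => Part.some (x.unpair.1 + x.unpair.2) :=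
      (Primrec.nat_add.to_comp.comp (Computable.fst.comp Computable.unpair)
        (Computable.snd.comp Computable.unpair)).natRecursiveIn O
    exact (hadd.comp (hi.pair (hs.comp hy))).of_eq fun x => by simp [Seq.seq]
  have hid : Nat.RecursiveIn O fun m => Part.some (Nat.pair 0 m) :=
    (Primrec₂.natPair.to_comp.comp (Computable.const 0) Computable.id).natRecursiveIn O
  refine ((Nat.RecursiveIn.prec .zero hstep).comp hid).of_eq fun m => ?_
  simp only [Part.bind_eq_bind, Part.bind_some, Nat.unpair_pair]
  induction m with
  | zero => rfl
  | succ m ih => simp [ih, Finset.sum_range_succ]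

/-- From `A` one can compute stages at which the members of `A` have appeared. -/
theorem exists_modulus {A : Set ℕ} {R : ℕ → ℕ → Bool} (hR : Computable₂ R)
    (hRA : ∀ n, n ∈ A ↔ ∃ s, R n s) :
    ∃ s : ℕ → ℕ, Nat.RecursiveIn {fun n => Part.some (RecThy.chi A n)}
      (fun n => Part.some (s n)) ∧ ∀ n ∈ A, R n (s n) := by
  -- The bit `i` will be the oracle's answer; `i = 0` stops the search at once, which keeps it total
  -- off `A`.
  obtain ⟨Q, hQ, hQR⟩ : ∃ Q : ℕ → ℕ → Bool, Computable₂ Q ∧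
      ∀ n i t, Q (Nat.pair n i) t ↔ i = 0 ∨ R n t := by
    refine ⟨fun x t => decide (x.unpair.2 = 0) || R x.unpair.1 t, ?_, by simp⟩
    have hu : Computable fun q : ℕ × ℕ => q.1.unpair := Computable.unpair.comp Computable.fst
    exact Primrec.or.to_comp.comp
      (Computable.decide_eq (Computable.snd.comp hu) (Computable.const 0))
      (hR.comp (Computable.fst.comp hu) Computable.snd)
  have hdom : ∀ n, (Nat.rfind fun t => Part.some (Q (Nat.pair n (RecThy.chi A n)) t)).Dom := by
    intro n
    rw [rfind_some_dom]
    by_cases hn : n ∈ A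
    · obtain ⟨t, ht⟩ := (hRA n).1 hn
      exact ⟨t, (hQR _ _ _).2 (.inr ht)⟩
    · exact ⟨0, (hQR _ _ _).2 (.inl (chi_of_notMem hn))⟩
  refine ⟨fun n => (Nat.rfind fun t => Part.some (Q (Nat.pair n (RecThy.chi A n)) t)).get (hdom n),
    ?_, fun n hn => ?_⟩
  · have hid : Nat.RecursiveIn {fun n => Part.some (RecThy.chi A n)} fun n : ℕ => Part.some n :=
      RecursiveIn.iff_nat.1 RecursiveIn.some
    have hQ' : Nat.RecursiveIn {fun n => Part.some (RecThy.chi A n)}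
        fun x => Nat.rfind fun t => Part.some (Q x t) :=
      RecursiveIn.iff_nat.1 hQ.rfind.recursiveIn
    refine (hQ'.comp (hid.pair (.oracle _ rfl))).of_eq fun n => ?_
    simp [Seq.seq]
  · have := Nat.rfind_spec (Part.get_mem (hdom n))
    have := (hQR _ _ _).1 (Part.mem_some_iff.1 this).symm
    simpa [chi_of_mem hn] using this

/-- The function waiting for a stage at which `n` appears, and answering whether `z` has appeared
by that stage. -/
theorem exists_delayed_approximation {R S : ℕ → ℕ → Bool} (hR : Computable₂ R)
    (hS : Computable₂ S) :
    ∃ g : ℕ → ℕ, Computable g ∧ ∀ n, (∃ s, S n s) →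
      ∃ s, S n s ∧ ∀ z, RecThy.phi (g n) z = Part.some (cond (R z s) 1 0) := by
  have hF : Partrec₂ fun n z => (Nat.rfind fun s => Part.some (S n s)).map fun s =>
      cond (R z s) 1 0 := by
    have h1 : Partrec fun p : ℕ × ℕ => Nat.rfind fun s => Part.some (S p.1 s) :=
      Computable₂.rfind (hS.comp (Computable.fst.comp Computable.fst) Computable.snd)
    have h2 : Computable fun q : (ℕ × ℕ) × ℕ => R q.1.2 q.2 :=
      hR.comp (Computable.snd.comp Computable.fst) Computable.snd
    exact Partrec.map h1 (Computable.cond h2 (Computable.const 1) (Computable.const 0)).to₂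
  obtain ⟨g, hg, hgF⟩ := exists_smn hF
  refine ⟨g, hg, fun n ⟨k, hk⟩ => ?_⟩
  have hd : (Nat.rfind fun s => Part.some (S n s)).Dom :=
    rfind_some_dom.2 ⟨k, hk⟩
  obtain ⟨s, hs⟩ := Part.dom_iff_mem.1 hd
  refine ⟨s, by simpa using Nat.rfind_spec hs, fun z => ?_⟩
  rw [hgF, Part.eq_some_iff.2 hs, Part.map_some]

theorem tComplete_of_dweu {A : Set ℕ} (hA : RecThy.DWEU A) : RecThy.TComplete A := by
  obtain ⟨hre, f, hf, hfA⟩ := hA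
  refine ⟨hre, fun B hB => ?_⟩
  obtain ⟨R, hR, hRmono, hRA⟩ := exists_stages hre
  obtain ⟨S, hS, hSmono, hSB⟩ := exists_stages hB
  obtain ⟨s, hs, hsA⟩ := exists_modulus hR hRA
  obtain ⟨g, hg, hgS⟩ := exists_delayed_approximation hR hS
  -- The sum stands in for a maximum: `T (m n)` bounds `s z` for every `z` in `f (g n)`.
  let T : ℕ → ℕ := fun m => ∑ i ∈ Finset.range m, s i
  let m : ℕ → ℕ := fun n => finsetCode (f (g n)) + 1
  have hkey : ∀ n, n ∈ B → S n (T (m n)) := by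
    intro n hn
    obtain ⟨t, ht, hval⟩ := hgS n ((hSB n).1 hn)
    by_cases hle : t ≤ T (m n)
    · exact hSmono _ _ _ hle ht
    -- Otherwise `A` has settled on `f (g n)` by stage `t`, so `g n` makes no error there.
    obtain ⟨z, hz, hne⟩ := hfA (g n) fun z _ => by rw [hval]; trivial
    refine absurd ?_ hne
    rw [hval]
    by_cases hzA : z ∈ A
    · have hsz : s z ≤ T (m n) := Finset.single_le_sum (f := s) (fun _ _ => Nat.zero_le _)
        (Finset.mem_range.2 (Nat.lt_succ_of_le (le_finsetCode_of_mem hz)))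
      rw [hRmono z _ t (hsz.trans (not_le.1 hle).le) (hsA z hzA), chi_of_mem hzA]
      rfl
    · have : R z t = false := by
        rw [← Bool.not_eq_true]
        exact fun h => hzA ((hRA z).2 ⟨t, h⟩)
      rw [this, chi_of_notMem hzA]
      rfl
  have hm : Computable m := Computable.succ.comp (computable_finsetCode.comp (hf.comp hg))
  have hS' : Computable fun x : ℕ => cond (S x.unpair.1 x.unpair.2) 1 0 :=
    Computable.cond (hS.comp (Computable.fst.comp Computable.unpair)
      (Computable.snd.comp Computable.unpair)) (Computable.const 1) (Computable.const 0)
  refine RecursiveIn.iff_nat.2 (((hS'.natRecursiveIn _).comp ((Computable.id.natRecursiveIn _).pair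
    ((recursiveIn_sum_range hs).comp (hm.natRecursiveIn _)))).of_eq fun n => ?_)
  have : RecThy.chi B n = cond (S n (T (m n))) 1 0 := by
    by_cases hn : n ∈ B
    · rw [hkey n hn, chi_of_mem hn]
      rfl
    · have : S n (T (m n)) = false := by
        rw [← Bool.not_eq_true]
        exact fun h => hn ((hSB n).2 ⟨_, h⟩)
      rw [this, chi_of_notMem hn]
      rfl
  rw [this]
  simp [Seq.seq, T]

theorem mainTheorem2 :
    (∀ (A : Set ℕ) (a : ℕ → ℕ), RecThy.DWEU A → RecThy.IsEnumeration a A →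
      RecThy.EffectivelySimple (RecThy.deficiencySet a)) ∧
    (∀ A : Set ℕ, RecThy.DWEU A → RecThy.TComplete A) ∧
    (∀ a : ℕ → ℕ, RecThy.IsEnumeration a RecThy.K →
      RecThy.EffectivelySimple (RecThy.deficiencySet a)) :=
  ⟨fun _ _ => effectivelySimple_deficiencySet, fun _ => tComplete_of_dweu,
    fun _ => effectivelySimple_deficiencySet dweu_K⟩
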